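/- Let $n\ge 2$ be even, let $m_1,\dots,m_n\ge 2$ be integers, and let $P\in\mathbb C[y]$ be a polynomial of degree $m\ge 2$ with non-zero discriminant. Put $g(x)=x_1^{m_1}+\dots+x_n^{m_n}$, $f=g(x)+P(y)$, $U=\{f=0\}\subset\mathbb C^{n+1}$, and let $X$ be a desingularization of the closure of $U$ in the weighted projective space with weights $(1,v_1,\dots,v_{n+1})$, $v_j=\operatorname{lcm}(m_1,\dots,m_{n+1})/m_j$, $m_{n+1}=m$. For $\beta\in\mathbb N^{n+1}$ put $\omega_\beta=x_1^{\beta_1}\cdots x_n^{\beta_n}y^{\beta_{n+1}}\,dx_1\wedge\dots\wedge dx_n\wedge dy$ and $A_\beta=\sum_{j=1}^{n+1}\frac{\beta_j+1}{m_j}$. For $r\ge 0$ let $V_r\subset H_n(U,\mathbb Q)$ be the space of all $\delta$ with $\int_\delta \operatorname{res}(\omega_\beta/f^j)=0$ for all $1\le j\le r$ and all $\beta$ with $A_\beta<j$. The space of primitive Hodge cycles is $\mathrm{Hod}_n(X,\mathbb Q)_0=V_{n/2}/V_{n+1}$. For $J=\prod_{j=1}^n\{0,\dots,m_j-2\}$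 let $\delta_\alpha$, $\alpha\in J$, be the cycle $\sum_{a\in\{0,1\}^n}(-1)^{\sum_i(1-a_i)}\Delta_{\alpha+a}$ on $\{g=1\}$, where $\Delta_e(t)=(t_1^{1/m_1}\zeta_{m_1}^{e_1},\dots,t_n^{1/m_n}\zeta_{m_n}^{e_n})$ on the standard $(n-1)$-simplex and $\zeta_d=e^{2\pi i/d}$. Choose simple arcs $\gamma_0,\dots,\gamma_{m-2}$ in the $y$-plane that join roots of $P$, contain no root in their interior, meet at most in endpoints, and whose boundaries form a basis of the reduced homology $\tilde H_0(\{P=0\},\mathbb Q)$, together with continuous branches of $(-P)^{1/m_j}$ along each arc. The joint cycle $\delta_k*\delta_\alpha\in H_n(U,\mathbb Q)$ is the suspension over $\gamma_k$ of $\delta_\alpha$, transported to the fibres $\{g=-P(y)\}$, $y\in\gamma_k$, by means of these branches. Let $$\mathcal A=\Big\{(n_{\alpha,k})\in\mathbb Q^{J\times\{0,\dots,m-2\}}\ \Big|\ \sum_{\alpha\in J}n_{\alpha,k}\prod_{j=1}^n\zeta_{m_j}^{\alpha_j(\beta_j+1)}=0\ \text{ for all } k \text{ and all } \beta\in J \text{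 with } \sum_{j=1}^n\tfrac{\beta_j+1}{m_j}<\tfrac n2-\tfrac1m\Big\}.$$ The space $\mathrm{SHod}_n(X,\mathbb Q)_0$ of strong generic Hodge cycles is the image of $\mathcal A$ under $(n_{\alpha,k})\mapsto\big[\sum_{k,\alpha}n_{\alpha,k}\,\delta_k*\delta_\alpha\big]\in H_n(U,\mathbb Q)/V_{n+1}$. Then, for every such choice of arcs and branches: (i) If $m_1=\dots=m_{n-1}=2$ and $m\ge 7$, then $\dim_{\mathbb Q}\mathrm{SHod}_n(X,\mathbb Q)_0\le m-1$ if $m_n$ is even, and $\mathrm{SHod}_n(X,\mathbb Q)_0=0$ if $m_n$ is odd. (ii) If $m_1=\dots=m_{n-2}=2$, $m_{n-1}$ is prime, $\gcd(m_{n-1},m_n)=1$ and $\frac1{m_{n-1}}+\frac1m<\frac12$, then $\mathrm{SHod}_n(X,\mathbb Q)_0=0$. (iii) If $m_1,\dots,m_n$ are pairwise distinct primes and, in case $n=2$, moreover $\frac1{m_1}+\frac1{m_2}+\frac1m<1$, then $\mathrm{SHod}_n(X,\mathbb Q)_0=0$. -/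

import Mathlib

open CategoryTheory Polynomial
open scoped ContDiff

noncomputable section

namespace StrongHodge

/-! ### Singular homology with rational coefficients -/

/-- The singular chain complex of `X` with coefficients in `ℚ`. -/
abbrev chains (X : Type) [TopologicalSpace X] : ChainComplex (ModuleCat.{0} ℚ) ℕ :=
  ((AlgebraicTopology.singularChainComplexFunctor (ModuleCat.{0} ℚ)).obj
    (ModuleCat.of ℚ ℚ)).obj (TopCat.of X)

/-- Singular homology `H_n(X, ℚ)`. -/
abbrev H (n : ℕ) (X : Type) [TopologicalSpace X] : ModuleCat.{0} ℚ :=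
  ((AlgebraicTopology.singularHomologyFunctor (ModuleCat.{0} ℚ) n).obj
    (ModuleCat.of ℚ ℚ)).obj (TopCat.of X)

/-- The singular `n`-simplices of `X`. -/
abbrev Simplex (n : ℕ) (X : Type) [TopologicalSpace X] : Type :=
  C(stdSimplex ℝ (Fin (n + 1)), X)

/-- The singular chain consisting of one simplex with coefficient one. -/
def simplexChain {n : ℕ} {X : Type} [TopologicalSpace X] (σ : Simplex n X) : (chains X).X n :=
  ((TopCat.toSSet.obj (TopCat.of X)).ιChainComplex (R := ModuleCat.of ℚ ℚ)
    (((TopCat.of X).toSSetObjEquiv (.op (SimplexCategory.mk n))).symm σ)).hom (1 : ℚ)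

/-- The `i`-th face of a singular simplex. -/
def face {n : ℕ} {X : Type} [TopologicalSpace X] (σ : Simplex (n + 1) X) (i : Fin (n + 2)) :
    Simplex n X :=
  σ.comp ⟨stdSimplex.map (Fin.succAbove i), stdSimplex.continuous_map _⟩

lemma d_simplexChain {n : ℕ} {X : Type} [TopologicalSpace X] (σ : Simplex (n + 1) X) :
    ((chains X).d (n + 1) n).hom (simplexChain σ) =
      ∑ i : Fin (n + 2), (-1 : ℚ) ^ (i : ℕ) • simplexChain (face σ i) := by
  have h := SSet.ιChainComplex_d (R := ModuleCat.of ℚ ℚ) (TopCat.toSSet.obj (TopCat.of X))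
    (((TopCat.of X).toSSetObjEquiv (.op (SimplexCategory.mk (n + 1)))).symm σ)
  have h' := congrArg (fun φ => φ.hom (1 : ℚ)) h
  simp only [ModuleCat.hom_comp, LinearMap.comp_apply] at h'
  refine h'.trans ?_
  rw [ModuleCat.hom_sum, LinearMap.sum_apply]
  refine Finset.sum_congr rfl fun i _ => ?_
  rw [ModuleCat.hom_zsmul, LinearMap.smul_apply, ← Int.cast_smul_eq_zsmul ℚ]
  push_cast
  rfl

/-- The group of singular `n`-cycles. -/
abbrev cycles (n : ℕ) (X : Type) [TopologicalSpace X] : Submodule ℚ ((chains X).X n) :=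
  LinearMap.ker ((chains X).d n ((ComplexShape.down ℕ).next n)).hom

lemma mem_cycles_succ {n : ℕ} {X : Type} [TopologicalSpace X] (z : (chains X).X (n + 1)) :
    z ∈ cycles (n + 1) X ↔ ((chains X).d (n + 1) n).hom z = 0 := by
  have h : (ComplexShape.down ℕ).next (n + 1) = n := ComplexShape.next_eq' _ rfl
  rw [LinearMap.mem_ker]
  generalize (ComplexShape.down ℕ).next (n + 1) = i at h
  subst h
  rfl

lemma mem_cycles_zero {X : Type} [TopologicalSpace X] (z : (chains X).X 0) :
    z ∈ cycles 0 X := by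
  rw [LinearMap.mem_ker, HomologicalComplex.shape]
  · rfl
  · simp [ComplexShape.down]

/-- The homology class of a singular cycle. -/
def homologyClass (n : ℕ) (X : Type) [TopologicalSpace X] : cycles n X →ₗ[ℚ] H n X :=
  ((chains X).liftCycles (ModuleCat.ofHom (cycles n X).subtype) _ rfl (by
    ext z
    exact z.2) ≫ (chains X).homologyπ n).hom

/-! ### The affine hypersurface `U = {g(x) + P(y) = 0}`

The coordinates of `ℂ^{n+1}` are indexed by `Fin (n + 1)`: the coordinates `x_1, …, x_n` are
`Fin.castSucc j`, and `y = x_{n+1}` is `Fin.last n`. -/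

/-- The polynomial `f = x_1^{m_1} + ⋯ + x_n^{m_n} + P(y)`. -/
def joinPoly {n : ℕ} (m : Fin n → ℕ) (P : ℂ[X]) : MvPolynomial (Fin (n + 1)) ℂ :=
  ∑ j : Fin n, MvPolynomial.X j.castSucc ^ m j + aeval (MvPolynomial.X (Fin.last n)) P

lemma eval_joinPoly {n : ℕ} (m : Fin n → ℕ) (P : ℂ[X]) (z : Fin (n + 1) → ℂ) :
    MvPolynomial.eval z (joinPoly m P) =
      ∑ j : Fin n, z j.castSucc ^ m j + P.eval (z (Fin.last n)) := by
  simp only [joinPoly, map_add, map_sum, map_pow, MvPolynomial.eval_X, add_right_inj]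
  induction P using Polynomial.induction_on' with
  | add p q hp hq => simp [hp, hq]
  | monomial k a => simp [Polynomial.aeval_monomial, MvPolynomial.algebraMap_eq]

/-- The affine variety `U = {f = 0} ⊆ ℂ^{n+1}`, with its analytic topology. -/
abbrev U {n : ℕ} (m : Fin n → ℕ) (P : ℂ[X]) : Type :=
  {z : Fin (n + 1) → ℂ // MvPolynomial.eval z (joinPoly m P) = 0}

/-! ### Polynomial differential forms, residues and integrals -/

/-- A polynomial `n`-form on `ℂ^{n+1}`: the family `η` stands for
`∑ i, η i dz_0 ∧ ⋯ ∧ (omit dz_i) ∧ ⋯ ∧ dz_n`. -/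
abbrev PolyForm (n : ℕ) : Type := Fin (n + 1) → MvPolynomial (Fin (n + 1)) ℂ

/-- The coefficient of `dz_0 ∧ ⋯ ∧ dz_n` in the exterior derivative `dξ`. -/
def extDeriv {n : ℕ} (ξ : PolyForm n) : MvPolynomial (Fin (n + 1)) ℂ :=
  ∑ i : Fin (n + 1), (-1) ^ (i : ℕ) * MvPolynomial.pderiv i (ξ i)

/-- The coefficient of `dz_0 ∧ ⋯ ∧ dz_n` in `df ∧ ξ`. -/
def dWedge {n : ℕ} (f : MvPolynomial (Fin (n + 1)) ℂ) (ξ : PolyForm n) :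
    MvPolynomial (Fin (n + 1)) ℂ :=
  ∑ i : Fin (n + 1), (-1) ^ (i : ℕ) * (MvPolynomial.pderiv i f * ξ i)

/-- `η` represents the residue along `{f = 0}` of the meromorphic form `ω_β / f^j`, where
`ω_β = z^β dz_0 ∧ ⋯ ∧ dz_n`. This means that `ω_β / f^j - (df / f) ∧ η` is exact on the
complement of `{f = 0}`, i.e. that it equals `d (ξ / f^N) = dξ / f^N - N df ∧ ξ / f^(N+1)` for
some polynomial form `ξ`; the equation below is this one multiplied by `f^(N+1+j)`. -/
def IsResidue {n : ℕ} (f : MvPolynomial (Fin (n + 1)) ℂ) (β : Fin (n + 1) →₀ ℕ) (j : ℕ)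
    (η : PolyForm n) : Prop :=
  ∃ (N : ℕ) (ξ : PolyForm n),
    MvPolynomial.monomial β 1 * f ^ (N + 1) =
      f ^ (N + j) * dWedge f η + f ^ (j + 1) * extDeriv ξ - (N : MvPolynomial (Fin (n + 1)) ℂ) * f ^ j * dWedge f ξ

/-- The simplex `{u ∈ ℝ^n | u_i ≥ 0, ∑ u_i ≤ 1}`. -/
def cornerSimplex (n : ℕ) : Set (Fin n → ℝ) := {u | (∀ i, 0 ≤ u i) ∧ ∑ i, u i ≤ 1}

/-- The point of the standard simplex with barycentric coordinates `(1 - ∑ u_i, u_1, …, u_n)`. -/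
def barycentric {n : ℕ} (u : Fin n → ℝ) (hu : u ∈ cornerSimplex n) :
    stdSimplex ℝ (Fin (n + 1)) :=
  ⟨Fin.cons (1 - ∑ i, u i) u, by
    refine ⟨fun i => ?_, ?_⟩
    · refine Fin.cases ?_ (fun j => ?_) i
      · simpa using hu.2
      · simpa using hu.1 j
    · simp [Fin.sum_univ_succ]⟩

open Classical in
/-- A singular simplex of a subspace of `ℂ^{n+1}`, as a function of the coordinates
`u ∈ cornerSimplex n` (extended by zero). -/
def inCoordinates {n : ℕ} {p : (Fin (n + 1) → ℂ) → Prop} (σ : Simplex n {z // p z})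
    (u : Fin n → ℝ) : Fin (n + 1) → ℂ :=
  if hu : u ∈ cornerSimplex n then (σ (barycentric u hu)).1 else 0

/-- Smooth singular simplices of a subspace of `ℂ^{n+1}`. -/
def IsSmooth {n : ℕ} {p : (Fin (n + 1) → ℂ) → Prop} (σ : Simplex n {z // p z}) : Prop :=
  ContDiffOn ℝ ∞ (inCoordinates σ) (cornerSimplex n)

/-- The integral of a polynomial `n`-form over a (smooth) singular `n`-simplex. -/
def simplexIntegral {n : ℕ} {p : (Fin (n + 1) → ℂ) → Prop} (η : PolyForm n)
    (σ : Simplex n {z // p z}) : ℂ :=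
  ∫ u in cornerSimplex n, ∑ i : Fin (n + 1),
    MvPolynomial.eval (inCoordinates σ u) (η i) *
      (Matrix.of fun a b : Fin n =>
        fderivWithin ℝ (inCoordinates σ) (cornerSimplex n) u (Pi.single b 1)
          (i.succAbove a)).det

/-- The integral of a polynomial `n`-form over a formal combination of simplices. -/
def chainIntegral {n : ℕ} {p : (Fin (n + 1) → ℂ) → Prop} (η : PolyForm n) :
    (Simplex n {z // p z} →₀ ℚ) →ₗ[ℚ] ℂ :=
  Finsupp.linearCombination ℚ (simplexIntegral η)

/-- The weight `A_β = ∑_{j=1}^{n+1} (β_j + 1) / m_j`, where `m_{n+1} = deg P`. -/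
def weight {n : ℕ} (m : Fin n → ℕ) (P : ℂ[X]) (β : Fin (n + 1) →₀ ℕ) : ℚ :=
  ∑ j : Fin n, ((β j.castSucc : ℚ) + 1) / m j + ((β (Fin.last n) : ℚ) + 1) / P.natDegree

/-- The smooth chains of `U` on which all the forms `res (ω_β / f^j)` with `A_β < j`,
`1 ≤ j ≤ r`, integrate to zero. -/
def vanishingChains {n : ℕ} (m : Fin n → ℕ) (P : ℂ[X]) (r : ℕ) :
    Submodule ℚ (Simplex n (U m P) →₀ ℚ) :=
  Finsupp.supported ℚ ℚ {σ | IsSmooth σ} ⊓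
    ⨅ (j : ℕ) (_ : 1 ≤ j ∧ j ≤ r) (β : Fin (n + 1) →₀ ℕ) (_ : weight m P β < j)
      (η : PolyForm n) (_ : IsResidue (joinPoly m P) β j η), LinearMap.ker (chainIntegral η)

/-- The space of all `δ ∈ H_n(U, ℚ)` such that `∫_δ res (ω_β / f^j) = 0` whenever `A_β < j`,
`1 ≤ j ≤ r`. Integrals are computed on smooth cycles representing `δ`. -/
def vanishing {n : ℕ} (m : Fin n → ℕ) (P : ℂ[X]) (r : ℕ) : Submodule ℚ (H n (U m P)) :=
  (((vanishingChains m P r).map (Finsupp.linearCombination ℚ simplexChain)).comap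
    (cycles n (U m P)).subtype).map (homologyClass n (U m P))

/-- `H_n(U, ℚ)` modulo the cycles all of whose periods `∫_δ res (ω_β / f^j)`, `A_β < j`,
`1 ≤ j ≤ n + 1`, vanish. -/
abbrev PrimitiveHomology {n : ℕ} (m : Fin n → ℕ) (P : ℂ[X]) : Type :=
  H n (U m P) ⧸ vanishing m P (n + 1)

/-- The space `Hod_n(X, ℚ)_0` of primitive Hodge cycles of a desingularization `X` of the
weighted compactification of `U`: the quotient of
`{δ | ∫_δ res (ω_β / f^j) = 0, A_β < j, 1 ≤ j ≤ n / 2}` by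
`{δ | ∫_δ res (ω_β / f^j) = 0, A_β < j, 1 ≤ j ≤ n + 1}`. -/
def Hod {n : ℕ} (m : Fin n → ℕ) (P : ℂ[X]) : Submodule ℚ (PrimitiveHomology m P) :=
  (vanishing m P (n / 2)).map (vanishing m P (n + 1)).mkQ

/-! ### Joint cycles -/

/-- The data needed to form the joint cycles `δ_k * δ_α`: for every `k` an arc in the `y`-plane
which joins two roots of `P` and avoids the roots otherwise, such that the arcs are simple, meet
at most at their endpoints, and their boundaries `[arc k 1] - [arc k 0]` are a basis of the reduced
homology `H̃_0({P = 0}, ℚ)` (so the arcs form an embedded tree whose vertices are the roots);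
along each arc, continuous branches of the roots `(-P(y))^{1 / m_j}`, which transport the cycles
of `{g = 1}` to the fibres `{g = -P(y)}`. When `y` runs along an arc, `P(y)` runs from `0` to `0`;
if the arc is a component of the preimage of a path from a critical value of `P` to `0`, then
it is swept out by the two points of a vanishing cycle of `P`. -/
structure JoinSystem {n : ℕ} (m : Fin n → ℕ) (P : ℂ[X]) where
  arc : Fin (P.natDegree - 1) → C(unitInterval, ℂ)
  arc_injective : ∀ k, Function.Injective (arc k)
  eval_arc_eq_zero_iff : ∀ k s, P.eval (arc k s) = 0 ↔ s = 0 ∨ s = 1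
  arc_disjoint : ∀ k l, k ≠ l → ∀ s t, arc k s = arc l t → s = 0 ∨ s = 1
  linearIndependent : LinearIndependent ℚ fun k =>
    (Finsupp.single (arc k 1) 1 - Finsupp.single (arc k 0) 1 : ℂ →₀ ℚ)
  branch : Fin (P.natDegree - 1) → Fin n → C(unitInterval, ℂ)
  branch_pow : ∀ k j s, branch k j s ^ m j = -P.eval (arc k s)

/-- The root of unity `ζ_d = exp (2πi / d)`. -/
def zeta (d : ℕ) : ℂ := Complex.exp (2 * Real.pi * Complex.I / d)

lemma zeta_pow {d : ℕ} (hd : d ≠ 0) : zeta d ^ d = 1 :=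
  (Complex.isPrimitiveRoot_exp d hd).pow_eq_one

/-- The number `1 - u_0` of a point `u` of the standard simplex. -/
def radius {n : ℕ} (u : stdSimplex ℝ (Fin (n + 1))) : unitInterval :=
  ⟨1 - u.1 0, by
    have h1 : u.1 0 ≤ 1 := by
      rw [← u.2.2]; exact Finset.single_le_sum (fun i _ => u.2.1 i) (Finset.mem_univ 0)
    exact ⟨by linarith, by linarith [u.2.1 0]⟩⟩

lemma radius_eq {n : ℕ} (u : stdSimplex ℝ (Fin (n + 1))) :
    (radius u : ℝ) = ∑ j : Fin n, u.1 j.succ := by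
  have h := u.2.2
  rw [Fin.sum_univ_succ] at h
  change 1 - u.1 0 = _
  linarith

lemma continuous_radius {n : ℕ} : Continuous (radius (n := n)) :=
  Continuous.subtype_mk (continuous_const.sub ((continuous_apply 0).comp continuous_subtype_val)) _

/-- The coordinate `b(r) (u_{j+1} / r)^{1/d} ζ_d^e`, where `r = 1 - u_0`. -/
def coneCoord {n : ℕ} (d : ℕ) (b : C(unitInterval, ℂ)) (e : ℕ) (j : Fin n)
    (u : stdSimplex ℝ (Fin (n + 1))) : ℂ :=
  b (radius u) * (((u.1 j.succ / (radius u : ℝ)) ^ (1 / (d : ℝ)) : ℝ) : ℂ) * zeta d ^ e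

lemma ratio_nonneg {n : ℕ} (j : Fin n) (u : stdSimplex ℝ (Fin (n + 1))) :
    0 ≤ u.1 j.succ / (radius u : ℝ) := div_nonneg (u.2.1 _) (radius u).2.1

lemma ratio_le_one {n : ℕ} (j : Fin n) (u : stdSimplex ℝ (Fin (n + 1))) :
    u.1 j.succ / (radius u : ℝ) ≤ 1 := by
  refine div_le_one_of_le₀ ?_ (radius u).2.1
  rw [radius_eq]
  exact Finset.single_le_sum (f := fun j : Fin n => u.1 j.succ)
    (fun i _ => u.2.1 _) (Finset.mem_univ j)

lemma coneCoord_pow {n : ℕ} {d : ℕ} (hd : d ≠ 0) (b : C(unitInterval, ℂ)) (e : ℕ) (j : Fin n)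
    (u : stdSimplex ℝ (Fin (n + 1))) :
    coneCoord d b e j u ^ d = b (radius u) ^ d * ((u.1 j.succ / (radius u : ℝ) : ℝ) : ℂ) := by
  have h : ((u.1 j.succ / (radius u : ℝ)) ^ (1 / (d : ℝ))) ^ d = u.1 j.succ / (radius u : ℝ) := by
    rw [one_div, Real.rpow_inv_natCast_pow (ratio_nonneg j u) hd]
  rw [coneCoord, mul_pow, mul_pow, ← pow_mul, mul_comm e d, pow_mul, zeta_pow hd, one_pow, mul_one,
    ← Complex.ofReal_pow, h]

lemma continuous_coneCoord {n : ℕ} {d : ℕ} (b : C(unitInterval, ℂ)) (hb : b 0 = 0)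
    (e : ℕ) (j : Fin n) : Continuous (coneCoord d b e j) := by
  have hr := continuous_radius (n := n)
  have hbr : Continuous fun u : stdSimplex ℝ (Fin (n + 1)) => b (radius u) := b.continuous.comp hr
  rw [continuous_iff_continuousAt]
  intro u
  refine ContinuousAt.mul ?_ continuousAt_const
  by_cases hu : radius u = 0
  · have h0 : b (radius u) = 0 := by rw [hu, hb]
    rw [ContinuousAt, h0, zero_mul]
    refine squeeze_zero_norm (a := fun v => ‖b (radius v)‖) (fun v => ?_) ?_
    · rw [norm_mul, Complex.norm_real, Real.norm_eq_abs,
        abs_of_nonneg (Real.rpow_nonneg (ratio_nonneg j v) _)]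
      exact mul_le_of_le_one_right (norm_nonneg _)
        (Real.rpow_le_one (ratio_nonneg j v) (ratio_le_one j v) (by positivity))
    · have := (hbr.norm).continuousAt (x := u)
      rwa [ContinuousAt, h0, norm_zero] at this
  · refine hbr.continuousAt.mul (Complex.continuous_ofReal.continuousAt.comp ?_)
    refine ContinuousAt.rpow_const ?_ (Or.inr (by positivity))
    refine ContinuousAt.div ?_ ?_ ?_
    · exact ((continuous_apply j.succ).comp continuous_subtype_val).continuousAt
    · exact (continuous_subtype_val.comp hr).continuousAt
    · exact fun h => hu (Subtype.ext h)

/-- Given a path `p` starting at a root of `P` and continuous branches `b_j` of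
`(-P(p(r)))^{1/m_j}`, the singular `n`-simplex
`u ↦ (b_1(r) (u_1/r)^{1/m_1} ζ_{m_1}^{e_1}, …, b_n(r) (u_n/r)^{1/m_n} ζ_{m_n}^{e_n}, p(r))`,
`r = 1 - u_0`, of `U`: the cone, with vertex `(0, p(0))`, swept out over the path by the simplices
`t ↦ (t_1^{1/m_1} ζ_{m_1}^{e_1}, …, t_n^{1/m_n} ζ_{m_n}^{e_n})` of `{g = 1}`, moved to
`{g = -P(p(r))}`. -/
def cone {n : ℕ} {m : Fin n → ℕ} {P : ℂ[X]} (hm : ∀ j, 2 ≤ m j) (p : C(unitInterval, ℂ))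
    (b : Fin n → C(unitInterval, ℂ)) (hb : ∀ j s, b j s ^ m j = -P.eval (p s))
    (h0 : P.eval (p 0) = 0) (e : Fin n → ℕ) : Simplex n (U m P) where
  toFun u := ⟨Fin.snoc (fun j => coneCoord (m j) (b j) (e j) j u) (p (radius u)), by
    have hm' : ∀ j, m j ≠ 0 := fun j => by have := hm j; omega
    rw [eval_joinPoly]
    simp only [Fin.snoc_castSucc, Fin.snoc_last, coneCoord_pow (hm' _), hb]
    rw [← Finset.mul_sum, ← Complex.ofReal_sum, ← Finset.sum_div, ← radius_eq]
    by_cases hr : radius u = 0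
    · simp [hr, h0]
    · rw [div_self fun h => hr (Subtype.ext h)]
      simp⟩
  continuous_toFun := by
    refine Continuous.subtype_mk (continuous_pi fun i => ?_) _
    refine Fin.lastCases ?_ (fun j => ?_) i
    · simp only [Fin.snoc_last]
      exact p.continuous.comp continuous_radius
    · simp only [Fin.snoc_castSucc]
      refine continuous_coneCoord _ ?_ _ _
      have := hb j 0
      rw [h0, neg_zero] at this
      exact pow_eq_zero_iff (by have := hm j; omega) |>.1 this

/-- The path in `[0, 1]` from `0` to `1/2` (for `c = false`) or from `1` to `1/2`
(for `c = true`). -/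
def half (c : Bool) : C(unitInterval, unitInterval) where
  toFun r := ⟨if c then 1 - (r : ℝ) / 2 else (r : ℝ) / 2, by
    have h0 := r.2.1
    have h1 := r.2.2
    cases c
    · exact ⟨by simp; linarith, by simp; linarith⟩
    · exact ⟨by simp; linarith, by simp; linarith⟩⟩
  continuous_toFun := by
    refine Continuous.subtype_mk ?_ _
    cases c
    · simp only [Bool.false_eq_true, if_false]; fun_prop
    · simp only [if_true]; fun_prop

lemma half_zero (c : Bool) : half c 0 = 0 ∨ half c 0 = 1 := by
  cases c
  · left; ext; simp [half]
  · right; ext; simp [half]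

lemma half_one (c : Bool) : half c 1 = half false 1 := by
  cases c
  · rfl
  · ext; simp [half]; norm_num

/-- The index set `J = I_{m_1} × ⋯ × I_{m_n}` with `I_d = {0, …, d - 2}`. -/
abbrev J {n : ℕ} (m : Fin n → ℕ) : Type := (j : Fin n) → Fin (m j - 1)

namespace JoinSystem

variable {n : ℕ} {m : Fin n → ℕ} {P : ℂ[X]}

/-- The cone over one of the halves of the `k`-th arc, with vertex at the root of `P` where this
half starts. -/
def halfCone (B : JoinSystem m P) (hm : ∀ j, 2 ≤ m j) (k : Fin (P.natDegree - 1)) (c : Bool)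
    (e : Fin n → ℕ) : Simplex n (U m P) :=
  cone hm ((B.arc k).comp (half c)) (fun j => (B.branch k j).comp (half c))
    (fun j s => B.branch_pow k j (half c s)) ((B.eval_arc_eq_zero_iff k _).2 (half_zero c)) e

/-- The joint cycle `δ_k * δ_α`, as a singular chain. It is the suspension of the cycle
`δ_α = ∑_{a ∈ {0,1}^n} (-1)^{∑ (1 - a_i)} Δ_{α + a}` along the `k`-th arc, where
`Δ_e(t) = (t_1^{1/m_1} ζ_{m_1}^{e_1}, …, t_n^{1/m_n} ζ_{m_n}^{e_n})`; each suspended simplex is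
the difference of the two cones over the halves of the arc. -/
def jointChain (B : JoinSystem m P) (hm : ∀ j, 2 ≤ m j) (k : Fin (P.natDegree - 1)) (α : J m) :
    (chains (U m P)).X n :=
  ∑ a : Fin n → Fin 2, (-1 : ℚ) ^ (∑ i, (1 - (a i : ℕ))) •
    (simplexChain (B.halfCone hm k true fun j => α j + a j) -
      simplexChain (B.halfCone hm k false fun j => α j + a j))

/-- A sum over `a ∈ {0,1}^n` with the signs of the cycle `δ_α` vanishes when its terms do not
depend on one of the `a_j`. -/
lemma signed_sum_eq_zero {M : Type*} [AddCommGroup M] [Module ℚ M] (j : Fin n)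
    (F : (Fin n → Fin 2) → M) (hF : ∀ a x, F (Function.update a j x) = F a) :
    ∑ a : Fin n → Fin 2, (-1 : ℚ) ^ (∑ i, (1 - (a i : ℕ))) • F a = 0 := by
  let τ : (Fin n → Fin 2) → (Fin n → Fin 2) := fun a => Function.update a j (1 - a j)
  have hτ : Function.Involutive τ := fun a => by
    simp only [τ, Function.update_self, Function.update_idem]
    rw [sub_sub_cancel, Function.update_eq_self]
  have hs : ∀ a, (-1 : ℚ) ^ (∑ i, (1 - (τ a i : ℕ))) = -(-1 : ℚ) ^ (∑ i, (1 - (a i : ℕ))) := by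
    intro a
    rw [← Finset.prod_pow_eq_pow_sum, ← Finset.prod_pow_eq_pow_sum,
      ← Finset.mul_prod_erase _ _ (Finset.mem_univ j),
      ← Finset.mul_prod_erase (a := j) (f := fun i => (-1 : ℚ) ^ (1 - (a i : ℕ))) _
        (Finset.mem_univ j), ← neg_mul]
    congr 1
    · simp only [τ, Function.update_self]
      generalize a j = x
      fin_cases x <;> simp
    · refine Finset.prod_congr rfl fun i hi => ?_
      simp only [τ, Function.update_of_ne (Finset.ne_of_mem_erase hi)]
  have h := Equiv.sum_comp (hτ.toPerm τ)
    (fun a : Fin n → Fin 2 => (-1 : ℚ) ^ (∑ i, (1 - (a i : ℕ))) • F a)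
  have h2 : ∀ a, (-1 : ℚ) ^ (∑ i, (1 - (hτ.toPerm τ a i : ℕ))) • F (hτ.toPerm τ a) =
      -((-1 : ℚ) ^ (∑ i, (1 - (a i : ℕ))) • F a) := by
    intro a
    change (-1 : ℚ) ^ (∑ i, (1 - (τ a i : ℕ))) • F (τ a) = _
    rw [hs, hF, neg_smul]
  rw [Finset.sum_congr rfl fun a _ => h2 a, Finset.sum_neg_distrib] at h
  have h3 : (2 : ℚ) • ∑ a : Fin n → Fin 2, (-1 : ℚ) ^ (∑ i, (1 - (a i : ℕ))) • F a = 0 := by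
    rw [two_smul]
    nth_rewrite 1 [← h]
    exact neg_add_cancel _
  exact (smul_eq_zero.1 h3).resolve_left two_ne_zero

end JoinSystem

lemma map_succAbove_self {n : ℕ} (i : Fin (n + 2)) (u : stdSimplex ℝ (Fin (n + 1))) :
    (stdSimplex.map (Fin.succAbove i) u).1 i = 0 := by
  change FunOnFinite.linearMap ℝ ℝ (Fin.succAbove i) u.1 i = 0
  rw [FunOnFinite.linearMap_apply_apply]
  exact Finset.sum_eq_zero fun x hx => absurd (Finset.mem_filter.1 hx).2 (Fin.succAbove_ne i x)

lemma coneCoord_eq_zero {n d : ℕ} (hd : d ≠ 0) (b : C(unitInterval, ℂ)) (e : ℕ) (j : Fin n)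
    (u : stdSimplex ℝ (Fin (n + 1))) (h : u.1 j.succ = 0) : coneCoord d b e j u = 0 := by
  have : (1 / (d : ℝ)) ≠ 0 := one_div_ne_zero (Nat.cast_ne_zero.2 hd)
  simp only [coneCoord, h, zero_div, Real.zero_rpow this, Complex.ofReal_zero, mul_zero, zero_mul]

namespace JoinSystem

variable {n : ℕ} {P : ℂ[X]}

lemma halfCone_castSucc {m : Fin n → ℕ} (B : JoinSystem m P) (hm : ∀ j, 2 ≤ m j)
    (k : Fin (P.natDegree - 1)) (c : Bool) (e : Fin n → ℕ) (u : stdSimplex ℝ (Fin (n + 1)))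
    (j : Fin n) : (B.halfCone hm k c e u).1 j.castSucc =
      coneCoord (m j) ((B.branch k j).comp (half c)) (e j) j u := by
  simp only [halfCone, cone, ContinuousMap.coe_mk, Fin.snoc_castSucc]

lemma halfCone_last {m : Fin n → ℕ} (B : JoinSystem m P) (hm : ∀ j, 2 ≤ m j)
    (k : Fin (P.natDegree - 1)) (c : Bool) (e : Fin n → ℕ) (u : stdSimplex ℝ (Fin (n + 1))) :
    (B.halfCone hm k c e u).1 (Fin.last n) = B.arc k (half c (radius u)) := by
  simp only [halfCone, cone, ContinuousMap.coe_mk, Fin.snoc_last, ContinuousMap.comp_apply]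

lemma face_zero_halfCone {m : Fin (n + 1) → ℕ} (B : JoinSystem m P) (hm : ∀ j, 2 ≤ m j)
    (k : Fin (P.natDegree - 1)) (e : Fin (n + 1) → ℕ) (c : Bool) :
    face (B.halfCone hm k c e) 0 = face (B.halfCone hm k false e) 0 := by
  ext u i
  have hr : radius (stdSimplex.map (Fin.succAbove 0) u) = 1 := by
    ext
    change 1 - (stdSimplex.map (Fin.succAbove 0) u).1 0 = 1
    rw [map_succAbove_self, sub_zero]
  change (B.halfCone hm k c e (stdSimplex.map (Fin.succAbove 0) u)).1 i =
    (B.halfCone hm k false e (stdSimplex.map (Fin.succAbove 0) u)).1 i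
  refine Fin.lastCases ?_ (fun j => ?_) i
  · rw [halfCone_last, halfCone_last, hr, half_one]
  · rw [halfCone_castSucc, halfCone_castSucc]
    simp only [coneCoord, hr, ContinuousMap.comp_apply]
    rw [half_one]

lemma face_succ_halfCone {m : Fin (n + 1) → ℕ} (B : JoinSystem m P) (hm : ∀ j, 2 ≤ m j)
    (k : Fin (P.natDegree - 1)) (j : Fin (n + 1)) (e e' : Fin (n + 1) → ℕ)
    (he : ∀ i, i ≠ j → e i = e' i) (c : Bool) :
    face (B.halfCone hm k c e) j.succ = face (B.halfCone hm k c e') j.succ := by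
  ext u i
  change (B.halfCone hm k c e (stdSimplex.map (Fin.succAbove j.succ) u)).1 i =
    (B.halfCone hm k c e' (stdSimplex.map (Fin.succAbove j.succ) u)).1 i
  refine Fin.lastCases ?_ (fun i => ?_) i
  · rw [halfCone_last, halfCone_last]
  · rw [halfCone_castSucc, halfCone_castSucc]
    by_cases hi : i = j
    · subst hi
      have hm' : m i ≠ 0 := by have := hm i; omega
      exact (coneCoord_eq_zero hm' _ _ _ _ (map_succAbove_self _ u)).trans
        (coneCoord_eq_zero hm' _ _ _ _ (map_succAbove_self _ u)).symm
    · rw [he i hi]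

lemma jointChain_mem_cycles {m : Fin n → ℕ} (B : JoinSystem m P) (hm : ∀ j, 2 ≤ m j)
    (k : Fin (P.natDegree - 1)) (α : J m) : B.jointChain hm k α ∈ cycles n (U m P) := by
  cases n with
  | zero => exact mem_cycles_zero _
  | succ n =>
    rw [mem_cycles_succ, jointChain, map_sum]
    simp only [map_smul, map_sub, d_simplexChain, ← Finset.sum_sub_distrib, ← smul_sub,
      Finset.smul_sum]
    rw [Finset.sum_comm]
    refine Finset.sum_eq_zero fun i _ => ?_
    refine Fin.cases ?_ (fun j => ?_) i
    · refine Finset.sum_eq_zero fun a _ => ?_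
      rw [face_zero_halfCone _ _ _ _ true, sub_self, smul_zero, smul_zero]
    · refine signed_sum_eq_zero j _ fun a x => ?_
      have h : ∀ c, face (B.halfCone hm k c fun i => α i + Function.update a j x i) j.succ =
          face (B.halfCone hm k c fun i => α i + a i) j.succ := fun c =>
        B.face_succ_halfCone hm k j _ _ (fun i hi => by rw [Function.update_of_ne hi]) c
      rw [h, h]

/-- The class of the joint cycle `δ_k * δ_α` in `H_n(U, ℚ)`. -/
def joint {m : Fin n → ℕ} (B : JoinSystem m P) (hm : ∀ j, 2 ≤ m j)
    (k : Fin (P.natDegree - 1)) (α : J m) : H n (U m P) :=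
  homologyClass n (U m P) ⟨B.jointChain hm k α, B.jointChain_mem_cycles hm k α⟩

end JoinSystem

/-! ### Strong generic Hodge cycles -/

/-- The space `𝒜` of all `(n_{α,k})` with
`∑_α n_{α,k} ∏_j ζ_{m_j}^{α_j (β_j + 1)} = 0` for all `k` and all `β = (β_1, …, β_n)`,
`0 ≤ β_j ≤ m_j - 2`, such that `∑_j (β_j + 1) / m_j < n / 2 - 1 / deg P`. -/
def coefficientSpace {n : ℕ} (m : Fin n → ℕ) (P : ℂ[X]) :
    Submodule ℚ (Fin (P.natDegree - 1) → J m → ℚ) where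
  carrier := {c | ∀ (k : Fin (P.natDegree - 1)) (β : J m),
    ∑ j, (((β j : ℕ) : ℚ) + 1) / m j < (n : ℚ) / 2 - 1 / P.natDegree →
      ∑ α : J m, (c k α : ℂ) * ∏ j, zeta (m j) ^ ((α j : ℕ) * ((β j : ℕ) + 1)) = 0}
  zero_mem' := fun k β _ => by simp
  add_mem' := fun {c c'} hc hc' k β h => by
    simp only [Pi.add_apply, Rat.cast_add, add_mul, Finset.sum_add_distrib]
    rw [hc k β h, hc' k β h, add_zero]
  smul_mem' := fun q c hc k β h => by
    simp only [Pi.smul_apply, smul_eq_mul, Rat.cast_mul, mul_assoc]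
    rw [← Finset.mul_sum, hc k β h, mul_zero]

/-- The natural map `(n_{α,k}) ↦ [∑_k ∑_α n_{α,k} δ_k * δ_α]`. -/
def joinMap {n : ℕ} {m : Fin n → ℕ} {P : ℂ[X]} (hm : ∀ j, 2 ≤ m j) (B : JoinSystem m P) :
    (Fin (P.natDegree - 1) → J m → ℚ) →ₗ[ℚ] PrimitiveHomology m P where
  toFun c := (vanishing m P (n + 1)).mkQ (∑ k, ∑ α : J m, c k α • B.joint hm k α)
  map_add' c c' := by
    rw [← map_add]
    simp only [Pi.add_apply, add_smul, Finset.sum_add_distrib]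
  map_smul' q c := by
    rw [RingHom.id_apply, ← map_smul]
    simp only [Pi.smul_apply, smul_eq_mul, mul_smul, Finset.smul_sum]

/-- The space `SHod_n(X, ℚ)_0` of strong generic Hodge cycles: the image of `𝒜` under the natural
map. -/
def SHod {n : ℕ} {m : Fin n → ℕ} {P : ℂ[X]} (hm : ∀ j, 2 ≤ m j) (B : JoinSystem m P) :
    Submodule ℚ (PrimitiveHomology m P) :=
  (coefficientSpace m P).map (joinMap hm B)

end StrongHodge
end

/-!
The strong generic Hodge cycles are the image of the space `𝒜` of rational coefficients, so it
suffices to show that `𝒜` is zero, or of dimension at most `m - 1`, where `m = deg P`. For every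
arc, the coefficients form a vector `c ∈ ℚ^J`, on which the functionals
`c ↦ ∑_α c_α ∏_j ζ_{m_j}^{α_j (β_j + 1)}`, `β ∈ J`, separate points: they are the values at the
points of a grid of a polynomial of small degree in each variable (`eq_zero_of_charSum_eq_zero`).

By definition of `𝒜`, such a functional vanishes if `∑_j (β_j + 1) / m_j < n / 2 - 1 / m`. As `c`
is rational, it vanishes as well if this inequality holds for some Galois conjugate of `β`, where
`t ∈ (ℤ / N)ˣ`, `N = ∏_j m_j`, multiplies `β_j + 1` by `t` modulo `m_j`
(`charSum_eq_zero_of_conj`). Let `d_j` be the denominator of `(β_j + 1) / m_j`. If those `d_j` which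
differ from `2` are pairwise coprime, some conjugate turns all the fractions into `1 / d_j`, and the
functional vanishes as soon as `1 / m < ∑_j (1 / 2 - 1 / d_j)` (`charSum_eq_zero_of_orders`).

If `m_{n-1}` is prime, prime to `m_n`, and the other exponents are `2`, the single term
`1 / 2 - 1 / m_{n-1}` is large enough. For distinct primes all the terms are known, since
`d_j = m_j`, and for `n ≥ 4` at least two of the primes are `≥ 5`. If all the exponents but `m_n`
are `2`, at most `d_n` differs from `2`, and the term `1 / 2 - 1 / d_n ≥ 1 / 6` suffices when
`m ≥ 7`, unless `d_n = 2`. This is impossible for odd `m_n`. For even `m_n` only the functional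
with `β_j + 1 = m_j / 2` remains for each of the `m - 1` arcs, and it takes rational values on
rational vectors, which bounds the dimension over `ℚ` (`rank_SHod_le`).
-/

namespace StrongHodge

variable {n : ℕ} {m : Fin n → ℕ}

/-! ### The character sums -/

/-- The value of the functional `∑_α c_α ∏_j ζ_{m_j}^{α_j (β_j + 1)}`. -/
noncomputable def charSum (c : J m → ℚ) (β : J m) : ℂ :=
  ∑ α : J m, (c α : ℂ) * ∏ j, zeta (m j) ^ ((α j : ℕ) * ((β j : ℕ) + 1))

/-- The order of `β_j + 1` in `ℤ / m_j`, i.e. the denominator of `(β_j + 1) / m_j` in lowest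
terms. -/
def charOrder (β : J m) (j : Fin n) : ℕ := m j / Nat.gcd ((β j : ℕ) + 1) (m j)

lemma gcd_mul_charOrder (β : J m) (j : Fin n) :
    Nat.gcd ((β j : ℕ) + 1) (m j) * charOrder β j = m j :=
  Nat.mul_div_cancel' (Nat.gcd_dvd_right _ _)

lemma charOrder_dvd (β : J m) (j : Fin n) : charOrder β j ∣ m j :=
  Dvd.intro_left _ (gcd_mul_charOrder β j)

lemma two_le_charOrder (β : J m) (j : Fin n) : 2 ≤ charOrder β j := by
  have h := gcd_mul_charOrder β j
  have hlt := (β j).2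
  have hle : Nat.gcd ((β j : ℕ) + 1) (m j) ≤ (β j : ℕ) + 1 := Nat.gcd_le_left _ (by omega)
  by_contra! hd
  interval_cases hq : charOrder β j <;> omega

lemma charOrder_eq_two {β : J m} {j : Fin n} (h : m j = 2) : charOrder β j = 2 :=
  le_antisymm (Nat.le_of_dvd two_pos (h ▸ charOrder_dvd β j)) (two_le_charOrder β j)

lemma charOrder_eq_of_prime {β : J m} {j : Fin n} (h : (m j).Prime) : charOrder β j = m j :=
  ((Nat.dvd_prime h).1 (charOrder_dvd β j)).resolve_left
    fun h1 => by have := two_le_charOrder β j; omega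

lemma half_sub_inv_charOrder_nonneg (β : J m) (j : Fin n) :
    (0 : ℚ) ≤ 1 / 2 - 1 / charOrder β j := by
  have : (2 : ℚ) ≤ charOrder β j := by exact_mod_cast two_le_charOrder β j
  rw [sub_nonneg]
  gcongr

lemma isPrimitiveRoot_zeta {d : ℕ} (hd : d ≠ 0) : IsPrimitiveRoot (zeta d) d :=
  Complex.isPrimitiveRoot_exp d hd

lemma zeta_mul_pow {d e : ℕ} (hd : d ≠ 0) (he : e ≠ 0) : zeta (d * e) ^ e = zeta d := by
  have hd' : (d : ℂ) ≠ 0 := Nat.cast_ne_zero.2 hd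
  have he' : (e : ℂ) ≠ 0 := Nat.cast_ne_zero.2 he
  rw [zeta, zeta, ← Complex.exp_nat_mul]
  congr 1
  push_cast
  field_simp

/-! ### Galois conjugation -/

/-- A rational polynomial relation satisfied by a primitive root of unity is satisfied by its
conjugates. -/
lemma aeval_pow_eq_zero {N t : ℕ} (hN : N ≠ 0) (ht : t.Coprime N) {ζ : ℂ}
    (hζ : IsPrimitiveRoot ζ N) {q : ℚ[X]} (hq : aeval ζ q = 0) : aeval (ζ ^ t) q = 0 := by
  rw [← minpoly.dvd_iff, ← cyclotomic_eq_minpoly_rat hζ (Nat.pos_of_ne_zero hN)] at hq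
  rwa [← minpoly.dvd_iff, ← cyclotomic_eq_minpoly_rat (hζ.pow_of_coprime t ht)
    (Nat.pos_of_ne_zero hN)]

/-- With `N = ∏_j m_j` and `ζ = ζ_N`, both functionals are values of one rational polynomial, at
`ζ` and at `ζ ^ t`. -/
lemma charSum_eq_zero_of_conj (hm : ∀ j, m j ≠ 0) (c : J m → ℚ) {β β' : J m} {t : ℕ}
    (ht : t.Coprime (∏ j, m j))
    (hβ : ∀ j, t * ((β' j : ℕ) + 1) ≡ (β j : ℕ) + 1 [MOD m j]) (h : charSum c β' = 0) :
    charSum c β = 0 := by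
  have hN : ∏ j, m j ≠ 0 := Finset.prod_ne_zero_iff.2 fun j _ => hm j
  set N := ∏ j, m j
  have hd : ∀ j, m j * (N / m j) = N := fun j =>
    Nat.mul_div_cancel' (Finset.dvd_prod_of_mem m (Finset.mem_univ j))
  have hz : ∀ j, zeta N ^ (N / m j) = zeta (m j) := fun j => by
    have := zeta_mul_pow (d := m j) (e := N / m j) (hm j)
      fun h0 => hN (by rw [← hd j, h0, mul_zero])
    rwa [hd] at this
  let q : ℚ[X] := ∑ α : J m, C (c α) *
    ∏ j, (X ^ (N / m j)) ^ ((α j : ℕ) * ((β' j : ℕ) + 1))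
  have hq : aeval (zeta N) q = charSum c β' := by
    simp [q, charSum, hz]
  have hq' : aeval (zeta N ^ t) q = charSum c β := by
    simp only [q, charSum, map_sum, map_mul, map_prod, map_pow, aeval_C, aeval_X, eq_ratCast]
    refine Finset.sum_congr rfl fun α _ => ?_
    congr 1
    refine Finset.prod_congr rfl fun j _ => ?_
    rw [pow_right_comm (zeta N) t, hz, ← pow_mul, mul_left_comm]
    exact pow_eq_pow_of_modEq ((hβ j).mul_left _) (zeta_pow (hm j))
  rw [← hq', aeval_pow_eq_zero hN ht (isPrimitiveRoot_zeta hN) (hq.trans h)]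

/-- Residues coprime to pairwise coprime moduli lift simultaneously to a unit modulo any given
multiple `N` of the moduli. -/
lemma exists_coprime_modEq {ι : Type*} (S : Finset ι) (a d : ι → ℕ) {N : ℕ} (hN : N ≠ 0)
    (hd : ∏ j ∈ S, d j ∣ N) (ha : ∀ j ∈ S, (a j).Coprime (d j))
    (hS : (S : Set ι).Pairwise (Function.onFun Nat.Coprime d)) :
    ∃ t : ℕ, t.Coprime N ∧ ∀ j ∈ S, t ≡ a j [MOD d j] := by
  have hd0 : ∏ j ∈ S, d j ≠ 0 := fun h => hN (Nat.eq_zero_of_zero_dvd (h ▸ hd))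
  obtain ⟨k, hk⟩ := Nat.chineseRemainderOfFinset a d S (Finset.prod_ne_zero_iff.1 hd0) hS
  have hcop : k.Coprime (∏ j ∈ S, d j) := Nat.Coprime.prod_right fun j hj => by
    rw [Nat.Coprime, (hk j hj).gcd_eq]
    exact ha j hj
  have : NeZero N := ⟨hN⟩
  obtain ⟨u, hu⟩ := ZMod.unitsMap_surjective hd (ZMod.unitOfCoprime k hcop)
  refine ⟨(u : ZMod N).val, ZMod.val_coe_unit_coprime u, fun j hj => ?_⟩
  have h1 : (((u : ZMod N).val : ℕ) : ZMod (∏ j ∈ S, d j)) = (k : ZMod (∏ j ∈ S, d j)) := by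
    have := congrArg Units.val hu
    rw [ZMod.unitsMap_val, ZMod.coe_unitOfCoprime] at this
    rw [← this, ZMod.cast_eq_val]
  exact (((ZMod.natCast_eq_natCast_iff _ _ _).1 h1).of_dvd (Finset.dvd_prod_of_mem d hj)).trans
    (hk j hj)

/-- If the orders different from `2` are pairwise coprime, the Chinese remainder theorem makes
the numerators of all the fractions `(β_j + 1) / m_j` equal to `1` by one Galois conjugation; an
odd exponent automatically fixes the fractions equal to `1 / 2`. The conjugate index has the weight
`∑_j 1 / d_j` with `d_j = charOrder β j`, and the assumption says that it is less than
`n / 2 - 1 / deg P`. -/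
lemma charSum_eq_zero_of_orders (hm : ∀ j, 2 ≤ m j) {P : ℂ[X]}
    {c : Fin (P.natDegree - 1) → J m → ℚ} (hc : c ∈ coefficientSpace m P)
    (k : Fin (P.natDegree - 1)) (β : J m)
    (hcop : ∀ i j, i ≠ j → charOrder β i ≠ 2 → charOrder β j ≠ 2 →
      (charOrder β i).Coprime (charOrder β j))
    (hw : (1 : ℚ) / P.natDegree < ∑ j, (1 / 2 - 1 / (charOrder β j : ℚ))) :
    charSum (c k) β = 0 := by
  have hm0 : ∀ j, m j ≠ 0 := fun j => by have := hm j; omega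
  have hN : ∏ j, m j ≠ 0 := Finset.prod_ne_zero_iff.2 fun j _ => hm0 j
  have hg : ∀ j, 0 < Nat.gcd ((β j : ℕ) + 1) (m j) := fun j => Nat.gcd_pos_of_pos_left _ (by omega)
  have hcd : ∀ j, (((β j : ℕ) + 1) / Nat.gcd ((β j : ℕ) + 1) (m j)).Coprime (charOrder β j) :=
    fun j => Nat.coprime_div_gcd_div_gcd (hg j)
  obtain ⟨t, htN, ht⟩ := exists_coprime_modEq
    (Finset.univ.filter fun j => charOrder β j ≠ 2)
    (fun j => ((β j : ℕ) + 1) / Nat.gcd ((β j : ℕ) + 1) (m j)) (charOrder β) hN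
    ((Finset.prod_dvd_prod_of_dvd _ _ fun j _ => charOrder_dvd β j).trans
      (Finset.prod_dvd_prod_of_subset _ _ m (Finset.subset_univ _)))
    (fun j _ => hcd j)
    (fun i hi j hj hij => hcop i j hij (by simpa using hi) (by simpa using hj))
  have ht' : ∀ j, t ≡ ((β j : ℕ) + 1) / Nat.gcd ((β j : ℕ) + 1) (m j) [MOD charOrder β j] := by
    intro j
    by_cases h2 : charOrder β j = 2
    · have h1 : t.Coprime 2 := h2 ▸ htN.coprime_dvd_right
        ((charOrder_dvd β j).trans (Finset.dvd_prod_of_mem m (Finset.mem_univ j)))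
      have h3 := hcd j
      rw [h2] at h3 ⊢
      rw [Nat.coprime_two_right, Nat.odd_iff] at h1 h3
      exact h1.trans h3.symm
    · exact ht j (by simpa using h2)
  -- the conjugate index, with `β'_j + 1 = gcd (β_j + 1, m_j)`
  let β' : J m := fun j => ⟨Nat.gcd ((β j : ℕ) + 1) (m j) - 1, by
    have h1 : Nat.gcd ((β j : ℕ) + 1) (m j) ≤ (β j : ℕ) + 1 := Nat.gcd_le_left _ (by omega)
    have h2 := (β j).2
    have h3 := hg j
    omega⟩
  have hβ' : ∀ j, (β' j : ℕ) + 1 = Nat.gcd ((β j : ℕ) + 1) (m j) := fun j =>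
    Nat.sub_add_cancel (hg j)
  refine charSum_eq_zero_of_conj hm0 (c k) (β' := β') htN (fun j => ?_) (hc k β' ?_)
  · have h := (ht' j).mul_right' (Nat.gcd ((β j : ℕ) + 1) (m j))
    rwa [Nat.div_mul_cancel (Nat.gcd_dvd_left _ _), mul_comm (charOrder β j),
      gcd_mul_charOrder, ← hβ'] at h
  · have h : ∀ j, (((β' j : ℕ) : ℚ) + 1) / m j = 1 / charOrder β j := fun j => by
      have h1 : (((β' j : ℕ) : ℚ) + 1) * charOrder β j = m j := by
        exact_mod_cast (hβ' j).symm ▸ gcd_mul_charOrder β j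
      have h2 : (m j : ℚ) ≠ 0 := Nat.cast_ne_zero.2 (hm0 j)
      have h3 : (charOrder β j : ℚ) ≠ 0 := fun h0 => h2 (by rw [← h1, h0, mul_zero])
      rw [div_eq_div_iff h2 h3, h1, one_mul]
    rw [Finset.sum_sub_distrib, Finset.sum_const, Finset.card_univ, Fintype.card_fin,
      nsmul_eq_mul] at hw
    rw [Finset.sum_congr rfl fun j _ => h j]
    linarith

/-! ### Separation by the characters -/

/-- The numbers `charSum c β` are the values of a polynomial of degree less than `m_j - 1` in the
`j`-th variable at the points of a grid with sides of lengths `m_j - 1`. -/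
lemma eq_zero_of_charSum_eq_zero (hm : ∀ j, 2 ≤ m j) {c : J m → ℚ}
    (h : ∀ β, charSum c β = 0) : c = 0 := by
  classical
  let e : J m → (Fin n →₀ ℕ) := fun α => Finsupp.equivFunOnFinite.symm fun j => (α j : ℕ)
  have he : Function.Injective e := fun α α' hα => by
    funext j
    exact Fin.ext (DFunLike.congr_fun hα j)
  let F : MvPolynomial (Fin n) ℂ := ∑ α : J m, MvPolynomial.monomial (e α) (c α : ℂ)
  have hcoeff : ∀ α, F.coeff (e α) = c α := fun α => by
    simp only [F, MvPolynomial.coeff_sum, MvPolynomial.coeff_monomial, he.eq_iff,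
      Finset.sum_ite_eq', Finset.mem_univ, if_true]
  let S : Fin n → Finset ℂ := fun j =>
    Finset.univ.image fun b : Fin (m j - 1) => zeta (m j) ^ ((b : ℕ) + 1)
  have hS : ∀ j, (S j).card = m j - 1 := fun j => by
    rw [Finset.card_image_of_injective, Finset.card_univ, Fintype.card_fin]
    intro b b' hb
    have := (isPrimitiveRoot_zeta (d := m j) (by have := hm j; omega)).pow_inj
      (by omega) (by omega) hb
    exact Fin.ext (by omega)
  have hF : F = 0 := by
    refine MvPolynomial.eq_zero_of_eval_zero_at_prod_finset F S (fun j => ?_) fun x hx => ?_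
    · rw [hS, MvPolynomial.degreeOf_lt_iff (by have := hm j; omega)]
      intro s hs
      obtain ⟨α, -, hα⟩ := Finset.mem_biUnion.1 (MvPolynomial.support_sum hs)
      rw [Finset.mem_singleton.1 (MvPolynomial.support_monomial_subset hα)]
      exact (α j).2
    · choose β _ hβ using fun j => Finset.mem_image.1 (hx j)
      rw [← h β, charSum, map_sum]
      refine Finset.sum_congr rfl fun α _ => ?_
      rw [MvPolynomial.eval_monomial, Finsupp.prod_fintype _ _ fun _ => pow_zero _]
      congr 1
      refine Finset.prod_congr rfl fun j _ => ?_
      rw [← hβ j, ← pow_mul, mul_comm]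
      rfl
  funext α
  have := hcoeff α
  rw [hF, MvPolynomial.coeff_zero] at this
  exact_mod_cast this.symm

/-- It suffices to show that the space of coefficients is zero; nothing has to be known about the
homology of the hypersurface. -/
lemma SHod_eq_bot {P : ℂ[X]} (hm : ∀ j, 2 ≤ m j) (B : JoinSystem m P)
    (h : ∀ c ∈ coefficientSpace m P, ∀ k β, charSum (c k) β = 0) : SHod hm B = ⊥ := by
  have h0 : coefficientSpace m P = ⊥ := by
    rw [Submodule.eq_bot_iff]
    exact fun c hc => funext fun k => eq_zero_of_charSum_eq_zero hm (h c hc k)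
  rw [SHod, h0, Submodule.map_bot]

/-! ### The quadratic character -/

/-- When all the orders are `2`, i.e. `β_j + 1 = m_j / 2`, each `ζ_{m_j}^{β_j + 1}` is `-1`, so the
functional takes rational values. -/
lemma charSum_of_orders_eq_two (hm : ∀ j, 2 ≤ m j) (c : J m → ℚ) {β : J m}
    (h : ∀ j, charOrder β j = 2) :
    charSum c β = ((∑ α : J m, c α * ∏ j, (-1 : ℚ) ^ (α j : ℕ) : ℚ) : ℂ) := by
  have hz : ∀ j, zeta (m j) ^ ((β j : ℕ) + 1) = -1 := fun j => by
    have hp := isPrimitiveRoot_zeta (d := m j) (by have := hm j; omega)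
    refine IsPrimitiveRoot.eq_neg_one_of_two_right (R := ℂ) ?_
    rw [IsPrimitiveRoot.iff_orderOf, orderOf_pow' _ (by omega), ← hp.eq_orderOf, Nat.gcd_comm]
    exact h j
  rw [charSum]
  push_cast
  refine Finset.sum_congr rfl fun α _ => ?_
  congr 1
  refine Finset.prod_congr rfl fun j _ => ?_
  rw [mul_comm, pow_mul, hz]

/-- If only the quadratic character can be non-zero on the coefficients `(c_k)`, its values for the
`deg P - 1` arcs are rational coordinates on the space of coefficients. -/
lemma rank_SHod_le {P : ℂ[X]} (hm : ∀ j, 2 ≤ m j) (B : JoinSystem m P)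
    (h : ∀ c ∈ coefficientSpace m P, ∀ k β, (∃ j, charOrder β j ≠ 2) → charSum (c k) β = 0) :
    Module.rank ℚ (SHod hm B) ≤ ((P.natDegree - 1 : ℕ) : Cardinal) := by
  let L : coefficientSpace m P →ₗ[ℚ] (Fin (P.natDegree - 1) → ℚ) :=
    { toFun := fun c k => ∑ α : J m, c.1 k α * ∏ j, (-1 : ℚ) ^ (α j : ℕ)
      map_add' := fun c c' => by
        funext k
        simp [add_mul, Finset.sum_add_distrib]
      map_smul' := fun q c => by
        funext k
        simp [mul_assoc, Finset.mul_sum] }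
  have hL : Function.Injective L := by
    rw [← LinearMap.ker_eq_bot, LinearMap.ker_eq_bot']
    intro c hc
    refine Subtype.ext (funext fun k => eq_zero_of_charSum_eq_zero hm fun β => ?_)
    by_cases h2 : ∀ j, charOrder β j = 2
    · rw [charSum_of_orders_eq_two hm _ h2, Rat.cast_eq_zero]
      exact congrFun hc k
    · exact h c.1 c.2 k β (not_forall.1 h2)
  calc Module.rank ℚ (SHod hm B) ≤ Module.rank ℚ (coefficientSpace m P) := rank_map_le _ _
    _ ≤ Module.rank ℚ (Fin (P.natDegree - 1) → ℚ) := L.rank_le_of_injective hL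
    _ = _ := by rw [rank_fun', Fintype.card_fin]

/-! ### Estimates for the weights -/

/-- As all the terms are non-negative, it is enough to bound one of them from below. -/
lemma lt_sum_half_sub_of_lt {β : J m} {x : ℚ} (j : Fin n)
    (h : x < 1 / 2 - 1 / charOrder β j) : x < ∑ j, (1 / 2 - 1 / (charOrder β j : ℚ)) :=
  h.trans_le (Finset.single_le_sum (f := fun j => (1 / 2 - 1 / (charOrder β j : ℚ)))
    (fun i _ => half_sub_inv_charOrder_nonneg β i) (Finset.mem_univ j))

/-- At most two of `n` distinct primes are less than `5`, and each of the others contributes at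
least `3 / 10` to the sum. -/
lemma half_lt_sum_half_sub_of_distinct_primes (hn : 4 ≤ n) (hp : ∀ j, (m j).Prime)
    (hinj : Function.Injective m) : (1 / 2 : ℚ) < ∑ j, (1 / 2 - 1 / (m j : ℚ)) := by
  have hnonneg : ∀ j, (0 : ℚ) ≤ 1 / 2 - 1 / (m j : ℚ) := fun j => by
    have : (2 : ℚ) ≤ m j := by exact_mod_cast (hp j).two_le
    rw [sub_nonneg]
    gcongr
  have hsmall : (Finset.univ.filter fun j => ¬ 5 ≤ m j).card ≤ 2 := by
    refine (Finset.card_le_card_of_injOn m (t := {2, 3}) (fun j hj => ?_) hinj.injOn).trans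
      (by decide)
    have h1 : m j < 5 := by simpa using hj
    have h2 := hp j
    interval_cases hq : m j <;> revert h2 <;> norm_num
  have hcard := Finset.card_filter_add_card_filter_not (s := (Finset.univ : Finset (Fin n)))
    (fun j => 5 ≤ m j)
  rw [Finset.card_univ, Fintype.card_fin] at hcard
  have hbig : (2 : ℚ) ≤ ((Finset.univ.filter fun j => 5 ≤ m j).card : ℚ) := by
    exact_mod_cast (by omega : 2 ≤ (Finset.univ.filter fun j => 5 ≤ m j).card)
  calc (1 / 2 : ℚ) < 2 * (3 / 10) := by norm_num
    _ ≤ (Finset.univ.filter fun j => 5 ≤ m j).card * (3 / 10) := by gcongr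
    _ = ∑ j ∈ Finset.univ.filter fun j => 5 ≤ m j, (3 / 10 : ℚ) := by
      rw [Finset.sum_const, nsmul_eq_mul]
    _ ≤ ∑ j ∈ Finset.univ.filter fun j => 5 ≤ m j, (1 / 2 - 1 / (m j : ℚ)) := by
      refine Finset.sum_le_sum fun j hj => ?_
      have h5 : (5 : ℚ) ≤ m j := by exact_mod_cast (Finset.mem_filter.1 hj).2
      have : 1 / (m j : ℚ) ≤ 1 / 5 := by gcongr
      linarith
    _ ≤ _ := Finset.sum_le_sum_of_subset_of_nonneg (Finset.filter_subset _ _)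
      fun j _ _ => hnonneg j

end StrongHodge

theorem mainTheorem1 (n : ℕ) (hn : 2 ≤ n) (hne : Even n) (m : Fin n → ℕ) (hm : ∀ j, 2 ≤ m j)
    (P : Polynomial ℂ) (hP : 2 ≤ P.natDegree) (hdisc : P.discr ≠ 0)
    (B : StrongHodge.JoinSystem m P) :
    ((∀ j : Fin n, (j : ℕ) + 1 < n → m j = 2) → 7 ≤ P.natDegree →
      (Even (m ⟨n - 1, by omega⟩) →
        Module.rank ℚ (StrongHodge.SHod hm B) ≤ ((P.natDegree - 1 : ℕ) : Cardinal)) ∧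
      (Odd (m ⟨n - 1, by omega⟩) → StrongHodge.SHod hm B = ⊥)) ∧
    ((∀ j : Fin n, (j : ℕ) + 2 < n → m j = 2) → (m ⟨n - 2, by omega⟩).Prime →
      Nat.gcd (m ⟨n - 2, by omega⟩) (m ⟨n - 1, by omega⟩) = 1 →
      1 / (m ⟨n - 2, by omega⟩ : ℝ) + 1 / (P.natDegree : ℝ) < 1 / 2 →
      StrongHodge.SHod hm B = ⊥) ∧
    ((∀ j, (m j).Prime) → Function.Injective m →
      (n = 2 → ∑ j, 1 / (m j : ℝ) + 1 / (P.natDegree : ℝ) < 1) →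
      StrongHodge.SHod hm B = ⊥) := by
  refine ⟨fun h2 hP7 => ?_, fun h2 hp hgcd hlt => ?_, fun hp hinj hlt => ?_⟩
  · have hdeg : (1 : ℚ) / P.natDegree ≤ 1 / 7 := by
      have : (7 : ℚ) ≤ P.natDegree := by exact_mod_cast hP7
      gcongr
    have hlast : ∀ (β : StrongHodge.J m) j, StrongHodge.charOrder β j ≠ 2 → (j : ℕ) = n - 1 := by
      intro β j hj
      by_contra hj'
      exact hj (StrongHodge.charOrder_eq_two (h2 j (by omega)))
    have key : ∀ c ∈ StrongHodge.coefficientSpace m P, ∀ k β,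
        (∃ j, StrongHodge.charOrder β j ≠ 2) → StrongHodge.charSum (c k) β = 0 := by
      rintro c hc k β ⟨j, hj⟩
      refine StrongHodge.charSum_eq_zero_of_orders hm hc k β (fun i i' hi h h' => ?_)
        (StrongHodge.lt_sum_half_sub_of_lt j ?_)
      · exact absurd (Fin.ext ((hlast β i h).trans (hlast β i' h').symm)) hi
      · have h3 : (3 : ℚ) ≤ StrongHodge.charOrder β j := by
          exact_mod_cast (by have := StrongHodge.two_le_charOrder β j; omega :
            3 ≤ StrongHodge.charOrder β j)
        have : 1 / (StrongHodge.charOrder β j : ℚ) ≤ 1 / 3 := by gcongr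
        linarith
    refine ⟨fun _ => StrongHodge.rank_SHod_le hm B key, fun hodd =>
      StrongHodge.SHod_eq_bot hm B fun c hc k β => key c hc k β ⟨⟨n - 1, by omega⟩, fun h => ?_⟩⟩
    have hdvd := StrongHodge.charOrder_dvd β ⟨n - 1, by omega⟩
    rw [h] at hdvd
    exact (Nat.not_even_iff_odd.2 hodd) (even_iff_two_dvd.2 hdvd)
  · refine StrongHodge.SHod_eq_bot hm B fun c hc k β =>
      StrongHodge.charSum_eq_zero_of_orders hm hc k β (fun i j hij hi hj => ?_)
        (StrongHodge.lt_sum_half_sub_of_lt ⟨n - 2, by omega⟩ ?_)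
    · have hlast : ∀ i, StrongHodge.charOrder β i ≠ 2 →
          i = ⟨n - 2, by omega⟩ ∨ i = ⟨n - 1, by omega⟩ := by
        intro i hi
        by_contra! hi'
        refine hi (StrongHodge.charOrder_eq_two (h2 i ?_))
        simp only [ne_eq, Fin.ext_iff] at hi'
        omega
      have hcop : (StrongHodge.charOrder β ⟨n - 2, by omega⟩).Coprime
          (StrongHodge.charOrder β ⟨n - 1, by omega⟩) :=
        Nat.Coprime.of_dvd (StrongHodge.charOrder_dvd β _) (StrongHodge.charOrder_dvd β _) hgcd
      rcases hlast i hi with rfl | rfl <;> rcases hlast j hj with rfl | rfl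
      · exact absurd rfl hij
      · exact hcop
      · exact hcop.symm
      · exact absurd rfl hij
    · rw [StrongHodge.charOrder_eq_of_prime hp, lt_sub_iff_add_lt']
      refine (Rat.cast_lt (K := ℝ)).1 ?_
      push_cast
      exact hlt
  · refine StrongHodge.SHod_eq_bot hm B fun c hc k β =>
      StrongHodge.charSum_eq_zero_of_orders hm hc k β (fun i j hij _ _ => ?_) ?_
    · rw [StrongHodge.charOrder_eq_of_prime (hp i), StrongHodge.charOrder_eq_of_prime (hp j)]
      exact (Nat.coprime_primes (hp i) (hp j)).2 (hinj.ne hij)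
    · simp only [fun j => StrongHodge.charOrder_eq_of_prime (β := β) (hp j)]
      rcases Nat.lt_or_ge n 4 with h4 | h4
      · obtain rfl : n = 2 := by
          obtain ⟨r, hr⟩ := hne
          omega
        have h : ∑ j, 1 / (m j : ℚ) + 1 / (P.natDegree : ℚ) < 1 := by
          refine (Rat.cast_lt (K := ℝ)).1 ?_
          push_cast
          exact hlt rfl
        rw [Fin.sum_univ_two] at h ⊢
        linarith
      · refine lt_of_le_of_lt ?_
          (StrongHodge.half_lt_sum_half_sub_of_distinct_primes h4 hp hinj)
        have : (2 : ℚ) ≤ P.natDegree := by exact_mod_cast hP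
        gcongr
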